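/- Let $k\ge 2$. Let $\gamma:\mathbf{C}\cup\{\infty\}\to\mathbf{P}^k$ be given by $\gamma(t)=[1:t:\dots:t^{k-1}:t^{k+1}]$ for $t\in\mathbf{C}$ and $\gamma(\infty)=[0:\dots:0:1]$. Let $C=\gamma(\mathbf{C}\cup\{\infty\})$ be the cuspidal elliptic normal curve, and let $C_{reg}=C\setminus\{\gamma(\infty)\}$ be its smooth part. Let $\mathbf{e}_0,\dots,\mathbf{e}_k\in\mathbf{P}^k$ be the coordinate points, and let $J[x_0:\dots:x_k]=[1/x_0:\dots:1/x_k]$ be the standard Cremona involution. A basic Cremona map is a rational map $F=S\circ J\circ T^{-1}$ with $S,T\in\mathrm{Aut}(\mathbf{P}^k)=PGL(k+1,\mathbf{C})$; let $I(F)$ denote its indeterminacy set. We say that $F=S\circ J\circ T^{-1}$ properly fixes $C$ if $T(\mathbf{e}_j)\in C_{reg}$ for all $j$ and $F(C)=C$, where $F(C)$ is the closure of the image of $C\setminus I(F)$. Theorem. Let $\delta\in\mathbf{C}^*$ and let $t_0^+,\dots,t_k^+\in\mathbf{C}$ be distinct parameters with $\sum_j t_j^+\ne 0$. Then there exist a unique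 basic Cremona map $F$ (unique as a rational map) and a unique $\tau\in\mathbf{C}$ such that, for some $S,T\in\mathrm{Aut}(\mathbf{P}^k)$ with $F=S\circ J\circ T^{-1}$: (1) $F$ properly fixes $C$, with $F|_C$ given by $F(\gamma(t))=\gamma(\delta t+\tau)$ for all $t\in\mathbf{C}\cup\{\infty\}$ with $\gamma(t)\notin I(F)$ (where $\delta\cdot\infty+\tau=\infty$); and (2) $T(\mathbf{e}_j)=\gamma(t_j^+)$ for each $0\le j\le k$. Moreover, for all $S,T\in\mathrm{Aut}(\mathbf{P}^k)$ and $\tau\in\mathbf{C}$ such that $F=S\circ J\circ T^{-1}$ satisfies (1) and (2), $$\tau=\frac{k-1}{k+1}\,\delta\sum_{j} t_j^+\qquad\text{and}\qquad S(\mathbf{e}_j)=\gamma\Bigl(\delta t_j^+-\frac{2\tau}{k-1}\Bigr)\quad\text{for each } 0\le j\le k.$$ -/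

import Mathlib

open scoped LinearAlgebra.Projectivization MatrixGroups

namespace Cremona

/-- Complex projective space of dimension `k`, with homogeneous coordinates `x 0, …, x k`. -/
abbrev PSpace (k : ℕ) : Type := ℙ ℂ (Fin (k + 1) → ℂ)

/-- The group of linear automorphisms of `PSpace k`, acting on `PSpace k` through Mathlib's
action of the projective general linear group. -/
abbrev Aut (k : ℕ) : Type := PGL(Fin (k + 1), ℂ)

/-- The coordinate point `[0 : … : 0 : 1 : 0 : … : 0]` with the `1` in position `j`. -/
noncomputable def coordPoint {k : ℕ} (j : Fin (k + 1)) : PSpace k :=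
  Projectivization.mk ℂ (Pi.single j 1) (by simp)

/-! ### The standard Cremona involution and basic Cremona maps -/

/-- The polynomial lift of the Cremona involution,
`x ↦ (∏ i, x i) • (1 / x 0, …, 1 / x k) = (∏ i ≠ j, x i)_j`. -/
def cremonaLift {k : ℕ} (x : Fin (k + 1) → ℂ) : Fin (k + 1) → ℂ :=
  fun j => ∏ i ∈ Finset.univ.erase j, x i

theorem cremonaLift_smul {k : ℕ} (a : ℂ) (x : Fin (k + 1) → ℂ) :
    cremonaLift (a • x) = a ^ k • cremonaLift x := by
  funext j
  simp [cremonaLift, Finset.prod_mul_distrib]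

/-- The standard Cremona involution `J [x 0 : … : x k] = [1 / x 0 : … : 1 / x k]`, as a partial
map. The components of `cremonaLift` have no common factor, so the maximal domain of definition
of the rational map `J` is the complement of their common zeros (that is, of the points with at
least two vanishing coordinates, see `cremona_dom_iff`). The value does not depend on the chosen
representative, see `cremona_mk`. -/
noncomputable def cremona (k : ℕ) : PSpace k →. PSpace k := fun p =>
  ⟨cremonaLift p.rep ≠ 0, fun h => Projectivization.mk ℂ (cremonaLift p.rep) h⟩

theorem cremona_mk {k : ℕ} (v : Fin (k + 1) → ℂ) (hv : v ≠ 0) :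
    cremona k (Projectivization.mk ℂ v hv) =
      ⟨cremonaLift v ≠ 0, fun h => Projectivization.mk ℂ (cremonaLift v) h⟩ := by
  obtain ⟨a, ha⟩ := Projectivization.exists_smul_eq_mk_rep ℂ v hv
  have h : cremonaLift (Projectivization.mk ℂ v hv).rep = ((a : ℂ) ^ k) • cremonaLift v := by
    rw [← ha, Units.smul_def, cremonaLift_smul]
  have hk : ((a : ℂ) ^ k) ≠ 0 := pow_ne_zero _ a.ne_zero
  refine Part.ext' ?_ ?_
  · simp [cremona, h]
  · intro h₁ h₂
    simp only [cremona]
    rw [Projectivization.mk_eq_mk_iff']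
    exact ⟨(a : ℂ) ^ k, h.symm⟩

theorem cremona_dom_iff {k : ℕ} (v : Fin (k + 1) → ℂ) (hv : v ≠ 0) :
    (cremona k (Projectivization.mk ℂ v hv)).Dom ↔ ¬ ∃ i j, i ≠ j ∧ v i = 0 ∧ v j = 0 := by
  rw [cremona_mk]
  change cremonaLift v ≠ 0 ↔ _
  rw [not_iff_not.symm, not_not, not_not]
  constructor
  · intro h
    have hz : ∀ j, ∃ i, i ≠ j ∧ v i = 0 := by
      intro j
      have := congrFun h j
      simpa [cremonaLift, Finset.prod_eq_zero_iff] using this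
    obtain ⟨i, -, hi⟩ := hz 0
    obtain ⟨j, hji, hj⟩ := hz i
    exact ⟨j, i, hji, hj, hi⟩
  · rintro ⟨i, j, hij, hi, hj⟩
    funext l
    by_cases hl : i = l
    · exact Finset.prod_eq_zero (Finset.mem_erase.2 ⟨fun h => hij (hl.trans h.symm),
        Finset.mem_univ j⟩) hj
    · exact Finset.prod_eq_zero (Finset.mem_erase.2 ⟨hl, Finset.mem_univ i⟩) hi

/-- The basic Cremona map `S ∘ J ∘ T⁻¹`, as a partial map defined on its maximal domain of
definition (the image under `T` of the domain of `J`). Two such rational maps coincide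
if and only if they are equal as partial maps. -/
noncomputable def basicCremona {k : ℕ} (S T : Aut k) : PSpace k →. PSpace k := fun p =>
  (cremona k (T⁻¹ • p)).map fun q => S • q

/-! ### The cuspidal elliptic normal curve -/

/-- The vector `(1, t, …, t ^ (k - 1), t ^ (k + 1))`. -/
def gammaVec (k : ℕ) (t : ℂ) : Fin (k + 1) → ℂ :=
  fun i => if i = Fin.last k then t ^ (k + 1) else t ^ (i : ℕ)

theorem gammaVec_ne_zero (k : ℕ) [k.AtLeastTwo] (t : ℂ) : gammaVec k t ≠ 0 := by
  intro h
  have h0 : (0 : Fin (k + 1)) ≠ Fin.last k := by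
    intro h'
    have := congrArg Fin.val h'
    simp only [Fin.val_zero, Fin.val_last] at this
    exact NeZero.ne k this.symm
  have := congrFun h 0
  simp [gammaVec, h0] at this

/-- The parametrization `γ : ℂ ∪ {∞} → PSpace k`, `γ t = [1 : t : … : t ^ (k - 1) : t ^ (k + 1)]`
for `t` in `ℂ`, and `γ ∞ = [0 : … : 0 : 1]`. -/
noncomputable def gamma (k : ℕ) [k.AtLeastTwo] : OnePoint ℂ → PSpace k
  | OnePoint.some t => Projectivization.mk ℂ (gammaVec k t) (gammaVec_ne_zero k t)
  | OnePoint.infty => coordPoint (Fin.last k)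

/-- The cuspidal elliptic normal curve `C`. -/
def curve (k : ℕ) [k.AtLeastTwo] : Set (PSpace k) := Set.range (gamma k)

/-- The regular part of `C`: the complement of the cusp `γ ∞`. -/
def curveReg (k : ℕ) [k.AtLeastTwo] : Set (PSpace k) := curve k \ {gamma k OnePoint.infty}

/-! ### Maps fixing the curve -/

/-- Zariski closure in projective space: the common zeros of all homogeneous polynomials that
vanish on `A` (for a homogeneous polynomial, vanishing at a point does not depend on the
representative). -/
def zariskiClosure {k : ℕ} (A : Set (PSpace k)) : Set (PSpace k) :=
  {p | ∀ (d : ℕ) (f : MvPolynomial (Fin (k + 1)) ℂ), f.IsHomogeneous d →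
    (∀ q ∈ A, MvPolynomial.eval q.rep f = 0) → MvPolynomial.eval p.rep f = 0}

/-- The proper image of `A` under a rational map `F`: the closure of the image under `F` of the
points of `A` at which `F` is defined. -/
def properImage {k : ℕ} (F : PSpace k →. PSpace k) (A : Set (PSpace k)) : Set (PSpace k) :=
  zariskiClosure (F.image A)

/-- The basic Cremona map `S ∘ J ∘ T⁻¹` is centered on `C`: all the points `T (e j)` lie in the
regular part of `C`. -/
def IsCentered {k : ℕ} [k.AtLeastTwo] (_S T : Aut k) : Prop :=
  ∀ j : Fin (k + 1), T • coordPoint j ∈ curveReg k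

/-- The basic Cremona map `S ∘ J ∘ T⁻¹` properly fixes `C`: it is centered on `C` and maps `C`
onto `C`. -/
def ProperlyFixes {k : ℕ} [k.AtLeastTwo] (S T : Aut k) : Prop :=
  IsCentered S T ∧ properImage (basicCremona S T) (curve k) = curve k

/-- The restriction of `F` to `C` is given by `F (γ t) = γ (δ * t + τ)`, at every point of `C`
(the cusp `t = ∞` included, with `δ * ∞ + τ = ∞`) outside the indeterminacy set of `F`. -/
def RestrictsTo {k : ℕ} [k.AtLeastTwo] (F : PSpace k →. PSpace k) (δ τ : ℂ) : Prop :=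
  ∀ t : OnePoint ℂ, (F (gamma k t)).Dom →
    gamma k (OnePoint.map (fun z : ℂ => δ * z + τ) t) ∈ F (gamma k t)

/-- The requirements on `F = S ∘ J ∘ T⁻¹` and `τ`, for a given multiplier `δ` and given
parameters `t j`: `F` properly fixes `C`, with `F (γ s) = γ (δ * s + τ)` on `C`, and
`T (e j) = γ (t j)` for all `j`. -/
structure IsSolution {k : ℕ} [k.AtLeastTwo] (δ : ℂ) (t : Fin (k + 1) → ℂ) (S T : Aut k)
    (τ : ℂ) : Prop where
  properlyFixes : ProperlyFixes S T
  restrictsTo : RestrictsTo (basicCremona S T) δ τ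
  base_points : ∀ j, T • coordPoint j = gamma k (t j : OnePoint ℂ)

end Cremona

namespace Cremona

/-! Restricted to `C`, a linear form is a polynomial in `u` of degree at most `k + 1` without `u ^
k` term, so the parameters of a hyperplane section in `C_reg` sum to zero. With `σ = ∑ t l`, the
hyperplane through the `γ (t i)`, `i ≠ j`, thus meets `C` once more, at parameter `t j - σ`. The
matrix of these forms sends `γ (t j)` to a nonzero multiple of `e j`, because `σ ≠ 0`; its inverse
serves as `T`. After removing common factors, `J` turns these forms into `(u - t j) * ∏ (u - t i +
σ)` over `i ≠ j`. In the variable `δ * u + τ` these are again such forms, for the points `s i = δ *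
t i + τ - δ * σ`, exactly when their zeros sum to zero; this forces `(k + 1) * τ = (k - 1) * δ * σ`.
The inverse matrix for `s` serves as `S` (`cremonaLift_hyperplaneMatrix_eq`). For uniqueness, the
base points fix `T` up to a diagonal matrix, which `J` moves over to `S`. Two solutions then differ
by a linear map that translates the parameter of `C`, and the missing `u ^ k` term makes it trivial
(`translation_trivial`). -/

open Polynomial Matrix

/-! ### Hyperplane sections of the curve -/

/-- The product of `X - b i` over `i ≠ j` and of the linear factor that makes the coefficient of
`X ^ k` vanish. -/
noncomputable def hyperplanePoly {k : ℕ} (b : Fin (k + 1) → ℂ) (j : Fin (k + 1)) : ℂ[X] :=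
  ∏ i, (X - C (Function.update b j (b j - ∑ l, b l) i))

theorem eval_hyperplanePoly {k : ℕ} (b : Fin (k + 1) → ℂ) (j : Fin (k + 1)) (u : ℂ) :
    (hyperplanePoly b j).eval u =
      (u - b j + ∑ l, b l) * ∏ i ∈ Finset.univ.erase j, (u - b i) := by
  rw [hyperplanePoly, eval_prod, ← Finset.mul_prod_erase _ _ (Finset.mem_univ j)]
  congr 1
  · rw [Function.update_self, eval_sub, eval_X, eval_C]
    ring
  · refine Finset.prod_congr rfl fun i hi => ?_
    simp [Function.update_of_ne (Finset.ne_of_mem_erase hi)]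

theorem natDegree_hyperplanePoly {k : ℕ} (b : Fin (k + 1) → ℂ) (j : Fin (k + 1)) :
    (hyperplanePoly b j).natDegree = k + 1 := by
  simp [hyperplanePoly, natDegree_finsetProd_X_sub_C_eq_card]

theorem coeff_succ_hyperplanePoly {k : ℕ} (b : Fin (k + 1) → ℂ) (j : Fin (k + 1)) :
    (hyperplanePoly b j).coeff (k + 1) = 1 := by
  have h : (hyperplanePoly b j).Monic := monic_prod_X_sub_C _ _
  rw [← natDegree_hyperplanePoly b j]
  exact h

theorem coeff_hyperplanePoly {k : ℕ} (b : Fin (k + 1) → ℂ) (j : Fin (k + 1)) :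
    (hyperplanePoly b j).coeff k = 0 := by
  have h := prod_X_sub_C_coeff_card_pred Finset.univ
    (Function.update b j (b j - ∑ l, b l)) (by simp)
  simp only [Finset.card_univ, Fintype.card_fin, Nat.add_sub_cancel] at h
  rw [hyperplanePoly, h, Finset.sum_update_of_mem (Finset.mem_univ j),
    ← Finset.add_sum_erase _ b (Finset.mem_univ j), Finset.sdiff_singleton_eq_erase]
  ring

/-- The matrix whose rows are the hyperplanes that cut the curve in the zeros of
`hyperplanePoly b j`. -/
noncomputable def hyperplaneMatrix {k : ℕ} (b : Fin (k + 1) → ℂ) :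
    Matrix (Fin (k + 1)) (Fin (k + 1)) ℂ :=
  Matrix.of fun j i => if i = Fin.last k then 1 else (hyperplanePoly b j).coeff i

/-- The coordinates of `γ` skip degree `k`, where `hyperplanePoly` has coefficient zero; the last
column of ones is its leading coefficient. -/
theorem hyperplaneMatrix_mulVec_gammaVec {k : ℕ} (b : Fin (k + 1) → ℂ) (u : ℂ) :
    hyperplaneMatrix b *ᵥ gammaVec k u = fun j => (hyperplanePoly b j).eval u := by
  funext j
  rw [eval_eq_sum_range, natDegree_hyperplanePoly, Finset.sum_range_succ, Finset.sum_range_succ,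
    coeff_hyperplanePoly, coeff_succ_hyperplanePoly, Finset.sum_range]
  simp [mulVec, dotProduct, Fin.sum_univ_castSucc, hyperplaneMatrix, gammaVec, Fin.castSucc_ne_last]

theorem hyperplaneMatrix_mulVec_single_last {k : ℕ} (b : Fin (k + 1) → ℂ) :
    hyperplaneMatrix b *ᵥ Pi.single (Fin.last k) 1 = 1 := by
  funext j
  simp [hyperplaneMatrix]

/-- The value of `hyperplanePoly b j` at `b j`. -/
noncomputable def hyperplaneDiag {k : ℕ} (b : Fin (k + 1) → ℂ) (j : Fin (k + 1)) : ℂ :=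
  (∑ l, b l) * ∏ i ∈ Finset.univ.erase j, (b j - b i)

theorem hyperplaneDiag_ne_zero {k : ℕ} {b : Fin (k + 1) → ℂ} (hb : Function.Injective b)
    (hs : ∑ l, b l ≠ 0) (j : Fin (k + 1)) : hyperplaneDiag b j ≠ 0 := by
  refine mul_ne_zero hs (Finset.prod_ne_zero_iff.2 fun i hi => sub_ne_zero.2 fun h => ?_)
  exact Finset.ne_of_mem_erase hi (hb h).symm

theorem hyperplaneMatrix_mulVec_gammaVec_self {k : ℕ} (b : Fin (k + 1) → ℂ) (j : Fin (k + 1)) :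
    hyperplaneMatrix b *ᵥ gammaVec k (b j) = Pi.single j (hyperplaneDiag b j) := by
  rw [hyperplaneMatrix_mulVec_gammaVec]
  funext i
  rw [eval_hyperplanePoly]
  by_cases h : i = j
  · subst h; simp [hyperplaneDiag]
  · rw [Pi.single_eq_of_ne h, Finset.prod_eq_zero (Finset.mem_erase.2 ⟨Ne.symm h,
      Finset.mem_univ j⟩) (sub_self _), mul_zero]

theorem hyperplaneMatrix_mul {k : ℕ} (b : Fin (k + 1) → ℂ) :
    hyperplaneMatrix b * (Matrix.of fun i j => gammaVec k (b j) i) =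
      Matrix.diagonal (hyperplaneDiag b) := by
  ext i j
  refine (congrFun (hyperplaneMatrix_mulVec_gammaVec_self b j) i).trans ?_
  rw [Matrix.diagonal_apply, Pi.single_apply]
  split_ifs with h
  · rw [h]
  · rfl

theorem det_hyperplaneMatrix_mul_ne_zero {k : ℕ} {b : Fin (k + 1) → ℂ}
    (hb : Function.Injective b) (hs : ∑ l, b l ≠ 0) :
    (hyperplaneMatrix b).det * (Matrix.of fun i j => gammaVec k (b j) i).det ≠ 0 := by
  rw [← Matrix.det_mul, hyperplaneMatrix_mul, Matrix.det_diagonal]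
  exact Finset.prod_ne_zero_iff.2 fun j _ => hyperplaneDiag_ne_zero hb hs j

/-- A matrix that vanishes on the curve is zero. -/
theorem eq_zero_of_mulVec_gammaVec {k : ℕ} {b : Fin (k + 1) → ℂ}
    (hb : Function.Injective b) (hs : ∑ l, b l ≠ 0) (A : Matrix (Fin (k + 1)) (Fin (k + 1)) ℂ)
    (hA : ∀ u, A *ᵥ gammaVec k u = 0) : A = 0 := by
  -- The vectors `γ (b j)` form a basis, being dual to the rows of `hyperplaneMatrix b` up to
  -- nonzero scalars.
  have hu : IsUnit (Matrix.of fun i j => gammaVec k (b j) i) := by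
    rw [Matrix.isUnit_iff_isUnit_det, isUnit_iff_ne_zero]
    exact right_ne_zero_of_mul (det_hyperplaneMatrix_mul_ne_zero hb hs)
  refine hu.mul_left_eq_zero.1 ?_
  ext i j
  exact congrFun (hA (b j)) i

/-! ### The Cremona involution along the curve -/

/-- The factor `u - b i` divides every form except the `i`-th. In the product of the forms other
than the `j`-th it therefore occurs `k - 1` times if `i ≠ j`, and `k` times if `i = j`. -/
theorem cremonaLift_hyperplaneMatrix {k : ℕ} (hk : 1 ≤ k) (b : Fin (k + 1) → ℂ) (u : ℂ) :
    cremonaLift (hyperplaneMatrix b *ᵥ gammaVec k u) =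
      (∏ i, (u - b i)) ^ (k - 1) •
        fun j => (u - b j) * ∏ i ∈ Finset.univ.erase j, (u - b i + ∑ l, b l) := by
  funext j
  rw [hyperplaneMatrix_mulVec_gammaVec]
  simp only [cremonaLift, eval_hyperplanePoly, Finset.prod_mul_distrib, Pi.smul_apply, smul_eq_mul]
  have key : ∏ x ∈ Finset.univ.erase j, ∏ i ∈ Finset.univ.erase x, (u - b i) =
      (∏ i, (u - b i)) ^ (k - 1) * (u - b j) := by
    have h1 : ∏ x ∈ Finset.univ.erase j, ∏ i ∈ Finset.univ.erase x, (u - b i) =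
        ∏ i, ∏ x ∈ (Finset.univ.erase j).erase i, (u - b i) := by
      refine Finset.prod_comm' fun x y => ?_
      simp only [Finset.mem_erase, Finset.mem_univ, and_true]
      tauto
    rw [h1, ← Finset.mul_prod_erase _ _ (Finset.mem_univ j),
      ← Finset.mul_prod_erase Finset.univ (fun i => u - b i) (Finset.mem_univ j)]
    have h2 : ∀ i ∈ Finset.univ.erase j, ∏ x ∈ (Finset.univ.erase j).erase i, (u - b i) =
        (u - b i) ^ (k - 1) := by
      intro i hi
      rw [Finset.prod_const, Finset.card_erase_of_mem hi,
        Finset.card_erase_of_mem (Finset.mem_univ _)]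
      simp
    rw [Finset.prod_congr rfl h2, Finset.prod_pow, Finset.prod_const, Finset.erase_idem,
      Finset.card_erase_of_mem (Finset.mem_univ _), mul_pow]
    obtain ⟨m, rfl⟩ := Nat.exists_eq_add_of_le' hk
    simp [pow_succ]
    ring
  rw [key]
  ring

/-- Both sides have the same zeros: `s i` is the image of `b i - ∑ l, b l` under `u ↦ δ * u + τ`,
and `hsum` makes the extra zero `s j - ∑ i, s i` the image of `b j`. -/
theorem hyperplanePoly_affine {k : ℕ} (b s : Fin (k + 1) → ℂ) (δ τ : ℂ)
    (hs : ∀ i, s i = δ * b i + τ - δ * ∑ l, b l) (hsum : ∑ i, s i = -(δ * ∑ l, b l)) (u : ℂ)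
    (j : Fin (k + 1)) :
    (hyperplanePoly s j).eval (δ * u + τ) =
      δ ^ (k + 1) * ((u - b j) * ∏ i ∈ Finset.univ.erase j, (u - b i + ∑ l, b l)) := by
  rw [eval_hyperplanePoly, hsum]
  have h : ∀ i ∈ Finset.univ.erase j, δ * u + τ - s i = δ * (u - b i + ∑ l, b l) := by
    intro i _; rw [hs]; ring
  rw [Finset.prod_congr rfl h, Finset.prod_mul_distrib, Finset.prod_const,
    Finset.card_erase_of_mem (Finset.mem_univ _), hs]
  simp
  ring

/-! ### Linear maps translating the parameter -/

/-- A linear automorphism that translates the parameter of the curve is scalar, and the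
translation is trivial. -/
theorem translation_trivial {k : ℕ} (hk : 2 ≤ k) {b : Fin (k + 1) → ℂ}
    (hb : Function.Injective b) (hs : ∑ l, b l ≠ 0) (G : Matrix (Fin (k + 1)) (Fin (k + 1)) ℂ)
    (hG : G ≠ 0) (ε : ℂ) (A : Set ℂ) (hA : A.Infinite)
    (h : ∀ v ∈ A, ∃ c : ℂ, G *ᵥ gammaVec k v = c • gammaVec k (v + ε)) :
    ε = 0 ∧ ∃ c : ℂ, G = c • (1 : Matrix (Fin (k + 1)) (Fin (k + 1)) ℂ) := by
  let g : Fin (k + 1) → ℂ[X] := fun i => if i = Fin.last k then X ^ (k + 1) else X ^ (i : ℕ)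
  have hg : ∀ i v, (g i).eval v = gammaVec k v i := by
    intro i v; simp only [g, gammaVec]; split_ifs <;> simp
  let R : Fin (k + 1) → ℂ[X] := fun i => ∑ j, C (G i j) * g j
  have hR : ∀ i v, (R i).eval v = (G *ᵥ gammaVec k v) i := by
    intro i v; simp [R, eval_finsetSum, hg, mulVec, dotProduct]
  have hgd : ∀ i, (g i).natDegree ≤ k + 1 := by
    intro i; simp only [g]; split_ifs
    · simp
    · rw [natDegree_X_pow]; exact i.is_lt.le
  have hgc : ∀ i, (g i).coeff k = 0 := by
    intro i; simp only [g]; split_ifs with hi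
    · simp [coeff_X_pow]
    · rw [coeff_X_pow, if_neg]
      intro h'; exact hi (Fin.ext h'.symm)
  have hRd : ∀ i, (R i).natDegree ≤ k + 1 := fun i =>
    natDegree_sum_le_of_forall_le _ _ fun j _ => (natDegree_C_mul_le _ _).trans (hgd j)
  have hRc : ∀ i, (R i).coeff k = 0 := by
    intro i; simp [R, finsetSum_coeff, hgc]
  have h0 : (0 : Fin (k + 1)) ≠ Fin.last k := by
    intro h'; have := congrArg Fin.val h'; simp at this; omega
  -- The coordinate `0` of `γ` is `1`, so `R 0` interpolates the unknown scalars `c`; agreement on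
  -- an infinite set gives a polynomial identity.
  have hrel : ∀ i, R i = R 0 * (g i).comp (X + C ε) := by
    intro i
    refine eq_of_infinite_eval_eq _ _ (hA.mono fun v hv => ?_)
    obtain ⟨c, hc⟩ := h v hv
    have h1 : gammaVec k (v + ε) 0 = 1 := by simp [gammaVec, h0]
    simp [hR, hc, hg, h1]
  have hlast : R (Fin.last k) = R 0 * (X + C ε) ^ (k + 1) := by
    rw [hrel]; simp [g]
  have hne : R 0 ≠ 0 := by
    intro h0
    refine hG (eq_zero_of_mulVec_gammaVec hb hs G fun u => ?_)
    funext i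
    rw [← hR, hrel, h0]; simp
  -- The factor `(X + C ε) ^ (k + 1)` already uses up the degree available to `R (Fin.last k)`.
  have hconst : (R 0).natDegree = 0 := by
    have h1 := hRd (Fin.last k)
    rw [hlast, natDegree_mul hne (pow_ne_zero _ (X_add_C_ne_zero ε)), natDegree_pow,
      natDegree_X_add_C] at h1
    omega
  obtain ⟨c, hc⟩ := natDegree_eq_zero.1 hconst
  have hc0 : c ≠ 0 := by rintro rfl; exact hne (by rw [← hc, C_0])
  -- The coefficient of `X ^ k` in `c * (X + ε) ^ (k + 1)` is `c * (k + 1) * ε`, and it must vanish.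
  have hε : ε = 0 := by
    have h1 := hRc (Fin.last k)
    rw [hlast, ← hc, coeff_C_mul, coeff_X_add_C_pow] at h1
    simp [hc0] at h1
    exact h1.resolve_right (by exact_mod_cast k.succ_ne_zero)
  refine ⟨hε, c, ?_⟩
  rw [← sub_eq_zero]
  refine eq_zero_of_mulVec_gammaVec hb hs _ fun u => ?_
  funext i
  rw [sub_mulVec, smul_mulVec, one_mulVec, Pi.sub_apply, ← hR, hrel, ← hc, hε]
  simp [hg]

/-! ### Zariski closures of subsets of the curve -/

theorem eval_smul_of_isHomogeneous {σ R : Type*} [CommSemiring R] {f : MvPolynomial σ R} {d : ℕ}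
    (hf : f.IsHomogeneous d) (a : R) (v : σ → R) :
    MvPolynomial.eval (a • v) f = a ^ d * MvPolynomial.eval v f := by
  rw [MvPolynomial.eval_eq, MvPolynomial.eval_eq, Finset.mul_sum]
  refine Finset.sum_congr rfl fun m hm => ?_
  have h : ∑ i ∈ m.support, m i = d := by
    have := hf (MvPolynomial.mem_support_iff.1 hm)
    rwa [show (1 : σ → ℕ) = fun _ => 1 from rfl, ← Finsupp.degree_eq_weight_one,
      Finsupp.degree_apply] at this
  simp only [Pi.smul_apply, smul_eq_mul, mul_pow, Finset.prod_mul_distrib,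
    Finset.prod_pow_eq_pow_sum, h]
  ring

theorem eval_rep_eq_zero_iff {k : ℕ} {f : MvPolynomial (Fin (k + 1)) ℂ} {d : ℕ}
    (hf : f.IsHomogeneous d) (v : Fin (k + 1) → ℂ) (hv : v ≠ 0) :
    MvPolynomial.eval (Projectivization.mk ℂ v hv).rep f = 0 ↔ MvPolynomial.eval v f = 0 := by
  obtain ⟨a, ha⟩ := Projectivization.exists_smul_eq_mk_rep ℂ v hv
  rw [← ha, Units.smul_def, eval_smul_of_isHomogeneous hf]
  simp

theorem eval_eq_zero_of_vanishes_on_curve {k : ℕ} [k.AtLeastTwo] {A : Set (PSpace k)}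
    (hA : A ⊆ curve k) {p : PSpace k} (hp : p ∈ zariskiClosure A)
    {f : MvPolynomial (Fin (k + 1)) ℂ} {d : ℕ} (hf : f.IsHomogeneous d)
    (hγ : ∀ u, MvPolynomial.eval (gammaVec k u) f = 0)
    (hinf : MvPolynomial.eval (Pi.single (Fin.last k) 1) f = 0) :
    MvPolynomial.eval p.rep f = 0 := by
  refine hp d f hf fun q hq => ?_
  obtain ⟨u, rfl⟩ := hA hq
  induction u using OnePoint.rec with
  | infty => exact (eval_rep_eq_zero_iff hf _ _).2 hinf
  | coe u => exact (eval_rep_eq_zero_iff hf _ _).2 (hγ u)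

/-- Explicit homogeneous equations cut out `C`: `hcusp` leaves only the cusp on `x 0 = 0`, while
`hpow` and `hlast` recover the point from the parameter `x 1 / x 0` elsewhere. -/
theorem zariskiClosure_subset_curve {k : ℕ} [k.AtLeastTwo] {A : Set (PSpace k)}
    (hA : A ⊆ curve k) : zariskiClosure A ⊆ curve k := by
  have hk : 2 ≤ k := Nat.AtLeastTwo.prop
  have h1v : ((1 : Fin (k + 1)) : ℕ) = 1 := by
    rw [Fin.val_one', Nat.mod_eq_of_lt (by omega)]
  have h0l : (0 : Fin (k + 1)) ≠ Fin.last k := by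
    intro h; have := congrArg Fin.val h; simp at this; omega
  have h1l : (1 : Fin (k + 1)) ≠ Fin.last k := by
    intro h; have := congrArg Fin.val h; rw [h1v, Fin.val_last] at this; omega
  have h1γ : ∀ u, gammaVec k u 1 = u := fun u => by
    rw [gammaVec, if_neg h1l, h1v, pow_one]
  intro p hp
  have hlt : ∀ i : Fin (k + 1), i ≠ Fin.last k → (i : ℕ) < k := fun i hi => by
    have := Fin.val_lt_last hi; simpa using this
  have hcusp : ∀ i : Fin (k + 1), i ≠ Fin.last k →
      p.rep i ^ (k + 1) = p.rep (Fin.last k) ^ (i : ℕ) * p.rep 0 ^ (k + 1 - i) := by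
    intro i hi
    have hf : (MvPolynomial.X i ^ (k + 1) - MvPolynomial.X (Fin.last k) ^ (i : ℕ) *
        MvPolynomial.X 0 ^ (k + 1 - i) : MvPolynomial (Fin (k + 1)) ℂ).IsHomogeneous (k + 1) := by
      refine (MvPolynomial.isHomogeneous_X_pow _ _).sub ?_
      have := (MvPolynomial.isHomogeneous_X_pow (R := ℂ) (Fin.last k) i).mul
        (MvPolynomial.isHomogeneous_X_pow (R := ℂ) (0 : Fin (k + 1)) (k + 1 - i))
      rwa [Nat.add_sub_of_le i.is_lt.le] at this
    refine sub_eq_zero.1 ?_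
    simpa using eval_eq_zero_of_vanishes_on_curve hA hp hf
      (fun u => by simp [gammaVec, hi, h0l]; ring)
      (by
        have : k + 1 - (i : ℕ) ≠ 0 := by have := hlt i hi; omega
        simp [hi, h0l, this])
  have hpow : ∀ i : Fin (k + 1), i ≠ Fin.last k →
      p.rep 0 ^ (i : ℕ) * p.rep i = p.rep 1 ^ (i : ℕ) * p.rep 0 := by
    intro i hi
    have hf : (MvPolynomial.X 0 ^ (i : ℕ) * MvPolynomial.X i - MvPolynomial.X 1 ^ (i : ℕ) *
        MvPolynomial.X 0 : MvPolynomial (Fin (k + 1)) ℂ).IsHomogeneous (i + 1) :=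
      ((MvPolynomial.isHomogeneous_X_pow _ _).mul (MvPolynomial.isHomogeneous_X _ _)).sub
        ((MvPolynomial.isHomogeneous_X_pow _ _).mul (MvPolynomial.isHomogeneous_X _ _))
    refine sub_eq_zero.1 ?_
    simpa using eval_eq_zero_of_vanishes_on_curve hA hp hf
      (fun u => by rw [map_sub]; simp [h1γ]; simp [gammaVec, hi, h0l])
      (by simp [hi, h0l])
  have hlast : p.rep 0 ^ k * p.rep (Fin.last k) = p.rep 1 ^ (k + 1) := by
    have hf : (MvPolynomial.X 0 ^ k * MvPolynomial.X (Fin.last k) - MvPolynomial.X 1 ^ (k + 1) :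
        MvPolynomial (Fin (k + 1)) ℂ).IsHomogeneous (k + 1) :=
      ((MvPolynomial.isHomogeneous_X_pow _ _).mul (MvPolynomial.isHomogeneous_X _ _)).sub
        (MvPolynomial.isHomogeneous_X_pow _ _)
    refine sub_eq_zero.1 ?_
    simpa using eval_eq_zero_of_vanishes_on_curve hA hp hf
      (fun u => by rw [map_sub]; simp [h1γ]; simp [gammaVec, h0l])
      (by simp [h0l, h1l, show k ≠ 0 by omega])
  by_cases h0 : p.rep 0 = 0
  · refine ⟨OnePoint.infty, Eq.trans ?_ p.mk_rep⟩
    have hz : ∀ i, i ≠ Fin.last k → p.rep i = 0 := by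
      intro i hi
      have h := hcusp i hi
      have : k + 1 - (i : ℕ) ≠ 0 := by have := hlt i hi; omega
      rw [h0, zero_pow this, mul_zero] at h
      exact pow_eq_zero_iff (Nat.succ_ne_zero k) |>.1 h
    have hne : p.rep (Fin.last k) ≠ 0 := fun hl => p.rep_nonzero <| funext fun i => by
      by_cases hi : i = Fin.last k
      · rw [hi, hl]; rfl
      · exact hz i hi
    refine (Projectivization.mk_eq_mk_iff' ℂ _ _ _ _).2 ⟨(p.rep (Fin.last k))⁻¹, ?_⟩
    funext i
    by_cases hi : i = Fin.last k
    · subst hi; simp [hne]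
    · simp [hi, hz i hi]
  · refine ⟨((p.rep 1 / p.rep 0 : ℂ) : OnePoint ℂ), Eq.trans ?_ p.mk_rep⟩
    refine (Projectivization.mk_eq_mk_iff' ℂ _ _ _ _).2 ⟨(p.rep 0)⁻¹, ?_⟩
    funext i
    by_cases hi : i = Fin.last k
    · subst hi
      simp only [Pi.smul_apply, smul_eq_mul, gammaVec, if_true, div_pow, ← hlast]
      field_simp
      ring
    · simp only [Pi.smul_apply, smul_eq_mul, gammaVec, hi, if_false, div_pow]
      have := hpow i hi
      field_simp
      linear_combination this

/-- Polynomials pulled back along `γ` are continuous, so density in the usual topology of `ℂ`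
suffices; the cusp is reached as a limit. -/
theorem curve_subset_zariskiClosure {k : ℕ} [k.AtLeastTwo] {A : Set (PSpace k)} {D : Set ℂ}
    (hD : Dense D) (hA : ∀ u ∈ D, gamma k (u : OnePoint ℂ) ∈ A) :
    curve k ⊆ zariskiClosure A := by
  rintro _ ⟨u, rfl⟩ d f hf hfA
  have hfin : ∀ u, MvPolynomial.eval (gammaVec k u) f = 0 := by
    refine congrFun (Continuous.ext_on hD (f := fun u => MvPolynomial.eval (gammaVec k u) f)
      (g := fun _ => 0) ?_ continuous_const fun u hu => ?_)
    · refine (MvPolynomial.continuous_eval f).comp (continuous_pi fun i => ?_)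
      unfold gammaVec
      split_ifs <;> fun_prop
    · exact (eval_rep_eq_zero_iff hf _ _).1 (hfA _ (hA u hu))
  induction u using OnePoint.rec with
  | coe u => exact (eval_rep_eq_zero_iff hf _ _).2 (hfin u)
  | infty =>
    refine (eval_rep_eq_zero_iff hf _ _).2 ?_
    -- The chart at the cusp: `w s = s ^ (k + 1) • γ (1 / s)` for `s ≠ 0`, extended polynomially to
    -- `s = 0`.
    let w : ℂ → Fin (k + 1) → ℂ := fun s i => s ^ (if i = Fin.last k then 0 else k + 1 - (i : ℕ))
    have hw : ∀ s, MvPolynomial.eval (w s) f = 0 := by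
      refine congrFun (Continuous.ext_on (dense_compl_singleton (0 : ℂ))
        (f := fun s => MvPolynomial.eval (w s) f) (g := fun _ => 0) ?_ continuous_const
        fun s hs => ?_)
      · exact (MvPolynomial.continuous_eval f).comp (continuous_pi fun i => by fun_prop)
      · have hs : s ≠ 0 := hs
        have : w s = s ^ (k + 1) • gammaVec k s⁻¹ := by
          funext i
          simp only [w, gammaVec, Pi.smul_apply, smul_eq_mul]
          split_ifs
          · rw [pow_zero, ← mul_pow, mul_inv_cancel₀ hs, one_pow]
          · rw [pow_sub₀ _ hs i.is_lt.le, inv_pow]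
        simp [this, eval_smul_of_isHomogeneous hf, hfin]
    convert hw 0 using 2
    refine congrArg _ (funext fun i => ?_)
    simp only [w]
    split_ifs with hi
    · simp [hi]
    · rw [zero_pow (by have := i.is_lt; omega), Pi.single_eq_of_ne hi]

/-! ### Basic Cremona maps in coordinates -/

theorem mem_basicCremona_mk {k : ℕ} (s g : GL (Fin (k + 1)) ℂ) (v : Fin (k + 1) → ℂ) (hv : v ≠ 0)
    (q : PSpace k) :
    q ∈ basicCremona (.mk s) (.mk g) (Projectivization.mk ℂ v hv) ↔
      ∃ h : cremonaLift (g⁻¹ • v) ≠ 0,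
        Projectivization.mk ℂ (s • cremonaLift (g⁻¹ • v)) ((smul_ne_zero_iff_ne s).2 h) = q := by
  rw [basicCremona, ← map_inv, Projectivization.PGL.mk_smul_mk, cremona_mk]
  rfl

theorem basicCremona_mk_dom {k : ℕ} (s g : GL (Fin (k + 1)) ℂ) (v : Fin (k + 1) → ℂ)
    (hv : v ≠ 0) :
    (basicCremona (.mk s) (.mk g) (Projectivization.mk ℂ v hv)).Dom ↔
      cremonaLift (g⁻¹ • v) ≠ 0 := by
  rw [Part.dom_iff_mem]
  simp only [mem_basicCremona_mk]
  exact ⟨fun ⟨_, h, _⟩ => h, fun h => ⟨_, h, rfl⟩⟩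

/-- Projectively, `J ∘ D⁻¹ = D ∘ J` for diagonal `D`. -/
theorem cremonaLift_inv_smul {k : ℕ} (D : GL (Fin (k + 1)) ℂ) (d : Fin (k + 1) → ℂ)
    (hD : (D : Matrix (Fin (k + 1)) (Fin (k + 1)) ℂ) = Matrix.diagonal d) (w : Fin (k + 1) → ℂ) :
    (∏ i, d i) • cremonaLift (D⁻¹ • w) = D • cremonaLift w := by
  obtain ⟨w, rfl⟩ : ∃ w', w = D • w' := ⟨D⁻¹ • w, by simp⟩
  rw [inv_smul_smul]
  have h : ∀ v : Fin (k + 1) → ℂ, D • v = fun i => d i * v i := by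
    intro v
    change (D : Matrix (Fin (k + 1)) (Fin (k + 1)) ℂ) *ᵥ v = _
    funext i
    rw [hD, mulVec_diagonal]
  rw [h, h]
  funext j
  simp only [cremonaLift, Pi.smul_apply, smul_eq_mul, Finset.prod_mul_distrib]
  rw [← Finset.mul_prod_erase _ d (Finset.mem_univ j), mul_assoc]

theorem prod_ne_zero_of_eq_diagonal {n : Type*} [Fintype n] [DecidableEq n] (D : GL n ℂ)
    (d : n → ℂ) (hD : (D : Matrix n n ℂ) = Matrix.diagonal d) : ∏ i, d i ≠ 0 := by
  have := (Matrix.isUnit_iff_isUnit_det _).1 D.isUnit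
  rwa [hD, Matrix.det_diagonal, isUnit_iff_ne_zero] at this

/-- A diagonal factor of `T` may be moved to `S`. -/
theorem basicCremona_mul_diagonal {k : ℕ} (s g D : GL (Fin (k + 1)) ℂ) (d : Fin (k + 1) → ℂ)
    (hD : (D : Matrix (Fin (k + 1)) (Fin (k + 1)) ℂ) = Matrix.diagonal d) :
    basicCremona (.mk s) (.mk (g * D)) = basicCremona (.mk (s * D)) (.mk g) := by
  funext p
  induction p using Projectivization.ind with | _ v hv =>
  have hc := prod_ne_zero_of_eq_diagonal D d hD
  have h := cremonaLift_inv_smul D d hD (g⁻¹ • v)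
  have h' : cremonaLift (D⁻¹ • g⁻¹ • v) ≠ 0 ↔ cremonaLift (g⁻¹ • v) ≠ 0 := by
    rw [← smul_ne_zero_iff_ne D (x := cremonaLift (g⁻¹ • v)), ← h]
    simp [hc]
  refine Part.ext fun q => ?_
  rw [mem_basicCremona_mk, mem_basicCremona_mk]
  simp only [_root_.mul_inv_rev, mul_smul]
  suffices hs : ∀ h₁ h₂, Projectivization.mk ℂ (s • cremonaLift (D⁻¹ • g⁻¹ • v)) h₁ =
      Projectivization.mk ℂ (s • D • cremonaLift (g⁻¹ • v)) h₂ from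
    ⟨fun ⟨h₁, hq⟩ => ⟨h'.1 h₁, (hs _ _).symm.trans hq⟩,
      fun ⟨h₂, hq⟩ => ⟨h'.2 h₂, (hs _ _).trans hq⟩⟩
  intro _ _
  refine (Projectivization.mk_eq_mk_iff' ℂ _ _ _ _).2 ⟨(∏ i, d i)⁻¹, ?_⟩
  rw [← h, smul_comm s, inv_smul_smul₀ hc]

/-! ### The basic Cremona map with prescribed base points -/

/-- The hyperplane matrix as an element of the general linear group. -/
noncomputable def hyperplaneGL {k : ℕ} {b : Fin (k + 1) → ℂ} (hb : Function.Injective b)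
    (hs : ∑ l, b l ≠ 0) : GL (Fin (k + 1)) ℂ :=
  Matrix.GeneralLinearGroup.mkOfDetNeZero (hyperplaneMatrix b)
    (left_ne_zero_of_mul (det_hyperplaneMatrix_mul_ne_zero hb hs))

theorem hyperplaneGL_smul {k : ℕ} {b : Fin (k + 1) → ℂ} (hb : Function.Injective b)
    (hs : ∑ l, b l ≠ 0) (v : Fin (k + 1) → ℂ) :
    hyperplaneGL hb hs • v = hyperplaneMatrix b *ᵥ v := rfl

theorem single_one_ne_zero {k : ℕ} (j : Fin (k + 1)) : (Pi.single j 1 : Fin (k + 1) → ℂ) ≠ 0 := by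
  simp

theorem hyperplaneGL_inv_smul_coordPoint {k : ℕ} [k.AtLeastTwo] {b : Fin (k + 1) → ℂ}
    (hb : Function.Injective b) (hs : ∑ l, b l ≠ 0) (j : Fin (k + 1)) :
    (ProjGenLinGroup.mk (hyperplaneGL hb hs)⁻¹ : Aut k) • coordPoint j =
      gamma k (b j : OnePoint ℂ) := by
  rw [map_inv, inv_smul_eq_iff]
  refine ((Projectivization.mk_eq_mk_iff' ℂ _ _ _ (single_one_ne_zero j)).2
    ⟨hyperplaneDiag b j, ?_⟩).symm
  change _ = hyperplaneMatrix b *ᵥ gammaVec k (b j)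
  rw [hyperplaneMatrix_mulVec_gammaVec_self, ← Pi.single_smul]
  simp

theorem smul_coordPoint_of_eq_diagonal {k : ℕ} (D : GL (Fin (k + 1)) ℂ) (d : Fin (k + 1) → ℂ)
    (hD : (D : Matrix (Fin (k + 1)) (Fin (k + 1)) ℂ) = Matrix.diagonal d) (j : Fin (k + 1)) :
    (ProjGenLinGroup.mk D : Aut k) • coordPoint j = coordPoint j := by
  refine (Projectivization.mk_eq_mk_iff' ℂ _ _ _ (single_one_ne_zero j)).2 ⟨d j, ?_⟩
  change _ = (D : Matrix (Fin (k + 1)) (Fin (k + 1)) ℂ) *ᵥ Pi.single j 1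
  rw [hD, diagonal_mulVec_single, ← Pi.single_smul]
  simp

theorem dense_compl_range_affine {ι : Type*} [Finite ι] (t : ι → ℂ) {δ : ℂ} (hδ : δ ≠ 0)
    (τ : ℂ) :
    Dense ((fun u => δ * u + τ) '' (Set.range t)ᶜ) := by
  have hd : Dense (Set.range t)ᶜ := (Set.finite_range t).countable.dense_compl ℂ
  have hsurj : Function.Surjective fun u : ℂ => δ * u + τ := fun v =>
    ⟨(v - τ) / δ, by field_simp; ring⟩
  exact hsurj.denseRange.dense_image (by fun_prop) hd

/-- The translation part of the restriction to the curve. -/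
noncomputable def translationPart {k : ℕ} (δ : ℂ) (t : Fin (k + 1) → ℂ) : ℂ :=
  ((k : ℂ) - 1) / ((k : ℂ) + 1) * δ * ∑ j, t j

/-- The parameters of the base points of the inverse. -/
noncomputable def inverseBase {k : ℕ} (δ : ℂ) (t : Fin (k + 1) → ℂ) (j : Fin (k + 1)) : ℂ :=
  δ * t j - 2 * translationPart δ t / ((k : ℂ) - 1)

/-- With `σ = ∑ l, t l` and `τ = translationPart δ t`, one has `2 * τ / (k - 1) = 2 * δ * σ / (k +
1) = δ * σ - τ`. This is the form that `hyperplanePoly_affine` needs. -/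
theorem inverseBase_eq {k : ℕ} (hk : 2 ≤ k) (δ : ℂ) (t : Fin (k + 1) → ℂ) (j : Fin (k + 1)) :
    inverseBase δ t j = δ * t j + translationPart δ t - δ * ∑ l, t l := by
  have h1 : (k : ℂ) - 1 ≠ 0 := by
    rw [sub_ne_zero]; exact_mod_cast (by omega : k ≠ 1)
  have h2 : (k : ℂ) + 1 ≠ 0 := by exact_mod_cast k.succ_ne_zero
  rw [inverseBase, translationPart]
  field_simp
  ring

/-- This identity is what determines `translationPart`: it amounts to `(k + 1) * τ = (k - 1) * δ * ∑
l, t l`. -/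
theorem sum_inverseBase {k : ℕ} (hk : 2 ≤ k) (δ : ℂ) (t : Fin (k + 1) → ℂ) :
    ∑ j, inverseBase δ t j = -(δ * ∑ l, t l) := by
  have h2 : (k : ℂ) + 1 ≠ 0 := by exact_mod_cast k.succ_ne_zero
  simp only [inverseBase_eq hk, Finset.sum_sub_distrib, Finset.sum_add_distrib, ← Finset.mul_sum,
    Finset.sum_const, Finset.card_univ, Fintype.card_fin, translationPart, nsmul_eq_mul]
  push_cast
  field_simp
  ring

theorem inverseBase_injective {k : ℕ} {δ : ℂ} (hδ : δ ≠ 0) {t : Fin (k + 1) → ℂ}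
    (ht : Function.Injective t) : Function.Injective (inverseBase δ t) := by
  intro i j h
  simp only [inverseBase, sub_left_inj] at h
  exact ht (mul_left_cancel₀ hδ h)

theorem sum_inverseBase_ne_zero {k : ℕ} (hk : 2 ≤ k) {δ : ℂ} (hδ : δ ≠ 0) {t : Fin (k + 1) → ℂ}
    (hsum : ∑ j, t j ≠ 0) : ∑ j, inverseBase δ t j ≠ 0 := by
  rw [sum_inverseBase hk]
  exact neg_ne_zero.2 (mul_ne_zero hδ hsum)

/-- On the curve, the Cremona involution becomes linear up to a scalar factor. -/
theorem cremonaLift_hyperplaneMatrix_eq {k : ℕ} (hk : 2 ≤ k) {δ : ℂ} (hδ : δ ≠ 0)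
    (t : Fin (k + 1) → ℂ) (u : ℂ) :
    cremonaLift (hyperplaneMatrix t *ᵥ gammaVec k u) =
      ((∏ i, (u - t i)) ^ (k - 1) * (δ ^ (k + 1))⁻¹) •
        hyperplaneMatrix (inverseBase δ t) *ᵥ gammaVec k (δ * u + translationPart δ t) := by
  rw [cremonaLift_hyperplaneMatrix (by omega), hyperplaneMatrix_mulVec_gammaVec, mul_smul]
  congr 1
  funext j
  rw [Pi.smul_apply, smul_eq_mul, hyperplanePoly_affine t (inverseBase δ t) δ (translationPart δ t)
    (inverseBase_eq hk δ t) (sum_inverseBase hk δ t), inv_mul_cancel_left₀ (pow_ne_zero _ hδ)]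

/-! ### Existence and uniqueness -/

section

variable {k : ℕ} [hk : k.AtLeastTwo] {δ : ℂ} (hδ : δ ≠ 0) {t : Fin (k + 1) → ℂ}
  (ht : Function.Injective t) (hsum : ∑ j, t j ≠ 0)

/-- The left factor `S` of the solution. -/
noncomputable def solutionS : Aut k :=
  .mk (hyperplaneGL (inverseBase_injective hδ ht) (sum_inverseBase_ne_zero hk.prop hδ hsum))⁻¹

/-- The right factor `T` of the solution. -/
noncomputable def solutionT : Aut k := .mk (hyperplaneGL ht hsum)⁻¹

/-- Along the curve the lift is an invertible matrix applied to a nonzero vector, times a scalar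
that vanishes exactly at the `t i`, as `k - 1 > 0`. -/
theorem solution_dom_iff (u : ℂ) :
    (basicCremona (solutionS hδ ht hsum) (solutionT ht hsum) (gamma k (u : OnePoint ℂ))).Dom ↔
      ∀ i, u ≠ t i := by
  refine (basicCremona_mk_dom _ _ _ _).trans ?_
  rw [inv_inv, hyperplaneGL_smul, cremonaLift_hyperplaneMatrix_eq hk.prop hδ, smul_ne_zero_iff,
    ← hyperplaneGL_smul (inverseBase_injective hδ ht) (sum_inverseBase_ne_zero hk.prop hδ hsum),
    smul_ne_zero_iff_ne]
  have h1 : k - 1 ≠ 0 := by have := hk.prop; omega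
  simp [gammaVec_ne_zero, hδ, Finset.prod_eq_zero_iff, sub_eq_zero, h1]

theorem restrictsTo_solution :
    RestrictsTo (basicCremona (solutionS hδ ht hsum) (solutionT ht hsum)) δ
      (translationPart δ t) := by
  intro u hu
  induction u using OnePoint.rec with
  | infty =>
    refine (mem_basicCremona_mk _ _ _ (single_one_ne_zero _) _).2
      ⟨(basicCremona_mk_dom _ _ _ _).1 hu, ?_⟩
    refine (Projectivization.mk_eq_mk_iff' ℂ _ _ _ (single_one_ne_zero _)).2 ⟨1, ?_⟩
    -- Both hyperplane matrices send the cusp to `[1 : … : 1]`, which `J` fixes.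
    rw [inv_inv, hyperplaneGL_smul, hyperplaneMatrix_mulVec_single_last, eq_inv_smul_iff, one_smul,
      hyperplaneGL_smul, hyperplaneMatrix_mulVec_single_last]
    funext j
    simp [cremonaLift]
  | coe u =>
    refine (mem_basicCremona_mk _ _ _ (gammaVec_ne_zero k u) _).2
      ⟨(basicCremona_mk_dom _ _ _ _).1 hu, ?_⟩
    refine (Projectivization.mk_eq_mk_iff' ℂ _ _ _ (gammaVec_ne_zero k _)).2
      ⟨(∏ i, (u - t i)) ^ (k - 1) * (δ ^ (k + 1))⁻¹, ?_⟩
    rw [inv_inv, hyperplaneGL_smul, cremonaLift_hyperplaneMatrix_eq hk.prop hδ, eq_inv_smul_iff,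
      smul_comm, hyperplaneGL_smul]

theorem gamma_coe_mem_curveReg (u : ℂ) : gamma k (u : OnePoint ℂ) ∈ curveReg k := by
  refine ⟨⟨_, rfl⟩, fun h => ?_⟩
  obtain ⟨a, ha⟩ := (Projectivization.mk_eq_mk_iff' ℂ _ _ (gammaVec_ne_zero k u)
    (single_one_ne_zero _)).1 h
  have h0 : (0 : Fin (k + 1)) ≠ Fin.last k := by
    intro h'
    have := congrArg Fin.val h'
    have := hk.prop
    simp at *
    omega
  have := congrFun ha 0
  simp [gammaVec, h0] at this

theorem properImage_solution :
    properImage (basicCremona (solutionS hδ ht hsum) (solutionT ht hsum)) (curve k) = curve k := by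
  have h := restrictsTo_solution hδ ht hsum
  refine (zariskiClosure_subset_curve ?_).antisymm
    (curve_subset_zariskiClosure (dense_compl_range_affine t hδ (translationPart δ t)) ?_)
  · rintro q ⟨_, ⟨u, rfl⟩, hq⟩
    rw [Part.mem_unique hq (h u (Part.dom_iff_mem.2 ⟨q, hq⟩))]
    exact ⟨_, rfl⟩
  · rintro _ ⟨u, hu, rfl⟩
    exact ⟨_, ⟨u, rfl⟩, h u ((solution_dom_iff hδ ht hsum u).2 fun i hi => hu ⟨i, hi.symm⟩)⟩

theorem isSolution_solution :
    IsSolution δ t (solutionS hδ ht hsum) (solutionT ht hsum) (translationPart δ t) where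
  properlyFixes := ⟨fun j => by
    rw [solutionT, hyperplaneGL_inv_smul_coordPoint]
    exact gamma_coe_mem_curveReg _, properImage_solution hδ ht hsum⟩
  restrictsTo := restrictsTo_solution hδ ht hsum
  base_points := hyperplaneGL_inv_smul_coordPoint ht hsum

/-- The right factor of a solution is determined up to a diagonal matrix. -/
theorem exists_eq_mul_diagonal (g : GL (Fin (k + 1)) ℂ)
    (hg : ∀ j, (ProjGenLinGroup.mk g : Aut k) • coordPoint j = gamma k (t j : OnePoint ℂ)) :
    ∃ (D : GL (Fin (k + 1)) ℂ) (d : Fin (k + 1) → ℂ),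
      (D : Matrix (Fin (k + 1)) (Fin (k + 1)) ℂ) = Matrix.diagonal d ∧
        g = (hyperplaneGL ht hsum)⁻¹ * D := by
  choose a ha using fun j => (Projectivization.mk_eq_mk_iff' ℂ _ _ ((smul_ne_zero_iff_ne g).2
    (single_one_ne_zero j)) (gammaVec_ne_zero k (t j))).1 (hg j)
  -- The product sends `e j` to `γ (t j)` and back to `e j`, with scalars `a j` and `hyperplaneDiag
  -- t j`.
  refine ⟨hyperplaneGL ht hsum * g, fun j => a j * hyperplaneDiag t j, ?_, by simp⟩
  ext i j
  have h : (hyperplaneGL ht hsum * g) • (Pi.single j 1 : Fin (k + 1) → ℂ) =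
      Pi.single j (a j * hyperplaneDiag t j) := by
    rw [mul_smul, ← ha, smul_comm, hyperplaneGL_smul, hyperplaneMatrix_mulVec_gammaVec_self,
      ← Pi.single_smul, smul_eq_mul]
  have h' : ((hyperplaneGL ht hsum * g : GL (Fin (k + 1)) ℂ) : Matrix _ _ ℂ) *ᵥ Pi.single j 1 =
      Pi.single j (a j * hyperplaneDiag t j) := h
  have h'' := congrFun h' i
  rw [mulVec_single_one, Pi.single_apply] at h''
  rw [diagonal_apply]
  refine h''.trans ?_
  split_ifs with hij
  · rw [hij]
  · rfl

theorem solution_unique {S T : Aut k} {τ : ℂ} (h : IsSolution δ t S T τ) :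
    τ = translationPart δ t ∧
      basicCremona S T = basicCremona (solutionS hδ ht hsum) (solutionT ht hsum) ∧
      ∀ j, S • coordPoint j = gamma k (inverseBase δ t j : OnePoint ℂ) := by
  obtain ⟨s, rfl⟩ := ProjGenLinGroup.mk_surjective S
  obtain ⟨g, rfl⟩ := ProjGenLinGroup.mk_surjective T
  have ht' := inverseBase_injective hδ ht
  have hsum' := sum_inverseBase_ne_zero hk.prop hδ hsum
  obtain ⟨D, d, hD, rfl⟩ := exists_eq_mul_diagonal ht hsum g h.base_points
  have hF := basicCremona_mul_diagonal s (hyperplaneGL ht hsum)⁻¹ D d hD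
  have hres := h.restrictsTo
  rw [hF] at hres
  let L := hyperplaneGL ht' hsum'
  -- This compares the left factor `s * D` with `solutionS`, the class of `L⁻¹`. Off the base points
  -- it carries `γ (δ * u + translationPart δ t)` to `γ (δ * u + τ)`.
  let G : GL (Fin (k + 1)) ℂ := s * D * L
  have hG : (G : Matrix (Fin (k + 1)) (Fin (k + 1)) ℂ) ≠ 0 := G.ne_zero
  obtain ⟨hε, c, hc⟩ := translation_trivial hk.prop ht hsum G.1 hG (τ - translationPart δ t)
    ((fun u => δ * u + translationPart δ t) '' (Set.range t)ᶜ)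
    ((Set.finite_range t).infinite_compl.image
      (fun u _ v _ huv => mul_left_cancel₀ hδ (add_right_cancel huv))) (by
    rintro _ ⟨u, hu, rfl⟩
    have hu' : (∏ i, (u - t i)) ^ (k - 1) * (δ ^ (k + 1))⁻¹ ≠ 0 := by
      refine mul_ne_zero (pow_ne_zero _ (Finset.prod_ne_zero_iff.2 fun i _ => sub_ne_zero.2 ?_))
        (inv_ne_zero (pow_ne_zero _ hδ))
      rintro rfl
      exact hu ⟨i, rfl⟩
    have hlift := cremonaLift_hyperplaneMatrix_eq hk.prop hδ t u
    have hdom := (solution_dom_iff hδ ht hsum u).2 fun i hi => hu ⟨i, hi.symm⟩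
    obtain ⟨h0, hmem⟩ := (mem_basicCremona_mk _ _ _ (gammaVec_ne_zero k u) _).1
      (hres u ((basicCremona_mk_dom _ _ _ _).2 ((basicCremona_mk_dom _ _ _ _).1 hdom)))
    obtain ⟨a, ha⟩ := (Projectivization.mk_eq_mk_iff' ℂ _ _ _ (gammaVec_ne_zero k _)).1 hmem
    rw [inv_inv, hyperplaneGL_smul, hlift, smul_comm] at ha
    refine ⟨((∏ i, (u - t i)) ^ (k - 1) * (δ ^ (k + 1))⁻¹)⁻¹ * a, ?_⟩
    rw [show δ * u + translationPart δ t + (τ - translationPart δ t) = δ * u + τ by ring, mul_smul,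
      ha, inv_smul_smul₀ hu']
    exact mul_smul (s * D) L (gammaVec k (δ * u + translationPart δ t)))
  have hc0 : c ≠ 0 := by
    rintro rfl
    exact hG (by rw [hc, zero_smul])
  have hS : (ProjGenLinGroup.mk (s * D) : Aut k) = solutionS hδ ht hsum := by
    have h1 : (ProjGenLinGroup.mk G : Aut k) = 1 := by
      rw [← ProjGenLinGroup.mk_scalar (Units.mk0 c hc0)]
      congr 1
      ext i j
      rw [hc]
      simp [Matrix.smul_apply, Matrix.one_apply, Matrix.diagonal_apply]
    rw [map_mul] at h1
    rw [solutionS, map_inv]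
    exact eq_inv_of_mul_eq_one_left h1
  refine ⟨sub_eq_zero.1 hε, ?_, fun j => ?_⟩
  · rw [hF, hS]; rfl
  · have hD' : (ProjGenLinGroup.mk (s * D) : Aut k) • coordPoint j =
        (ProjGenLinGroup.mk s : Aut k) • coordPoint j := by
      rw [map_mul, mul_smul, smul_coordPoint_of_eq_diagonal D d hD]
    rw [← hD', hS]
    exact hyperplaneGL_inv_smul_coordPoint ht' hsum' j

end

end Cremona

theorem mainTheorem1 (k : ℕ) [k.AtLeastTwo] (δ : ℂ) (hδ : δ ≠ 0) (t : Fin (k + 1) → ℂ)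
    (ht : Function.Injective t) (hsum : ∑ j, t j ≠ 0) :
    (∃! q : (Cremona.PSpace k →. Cremona.PSpace k) × ℂ,
      ∃ S T : Cremona.Aut k,
        q.1 = Cremona.basicCremona S T ∧ Cremona.IsSolution δ t S T q.2) ∧
    ∀ (S T : Cremona.Aut k) (τ : ℂ), Cremona.IsSolution δ t S T τ →
      τ = ((k : ℂ) - 1) / ((k : ℂ) + 1) * δ * ∑ j, t j ∧
      ∀ j, S • Cremona.coordPoint j =
        Cremona.gamma k ((δ * t j - 2 * τ / ((k : ℂ) - 1) : ℂ) : OnePoint ℂ) := by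
  refine ⟨⟨(Cremona.basicCremona (Cremona.solutionS hδ ht hsum) (Cremona.solutionT ht hsum),
    Cremona.translationPart δ t), ⟨_, _, rfl, Cremona.isSolution_solution hδ ht hsum⟩, ?_⟩, ?_⟩
  · rintro ⟨F, τ⟩ ⟨S, T, rfl, h⟩
    obtain ⟨hτ, hF, -⟩ := Cremona.solution_unique hδ ht hsum h
    exact Prod.ext hF hτ
  · intro S T τ h
    obtain ⟨rfl, -, hS⟩ := Cremona.solution_unique hδ ht hsum h
    exact ⟨rfl, hS⟩
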